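/- For $v\in\mathbb{C}\setminus\{0,-1,-2,\dots\}$ let $\zeta(s,v)$ be the Hurwitz zeta function, the analytic continuation in $s$ of $\sum_{j\ge 0}(j+v)^{-s}$ ($\operatorname{Re}s>1$, principal powers), and let $\gamma_k(v)$ be the generalized Stieltjes constants, defined by the Laurent expansion at $s=1$ $$\zeta(s,v)=\frac1{s-1}+\sum_{k\ge 0}\frac{(-1)^k}{k!}\,\gamma_k(v)\,(s-1)^k .$$ Let $\psi^{(0)}=\Gamma'/\Gamma$ be the digamma function, $H_z=\psi^{(0)}(z+1)+\gamma$ the harmonic number of complex index $z$ (with $\gamma$ Euler's constant), and $\log$ the principal logarithm. Let $n\ge 0$ be an integer and let $a\in\mathbb{C}$ be such that $2^n a\notin\{-1,-2,-3,\dots\}$ (equivalently, no term below is evaluated at a pole). Then $$\begin{aligned} \sum_{p=0}^{n}\Big(&\log(i2^{1-p})\big(H_{2^{p-2}a}-H_{\frac14(2^pa-2)}\big)+2\log(i2^{-p})\big(H_{\frac12(2^pa-1)}-H_{2^{p-1}a}\big)\\ &-\gamma_1(2^{p-2}a+1)+2\gamma_1(2^{p-1}a+1)-2\gamma_1\big(\tfrac12(2^pa+1)\big)+\gamma_1\big(\tfrac14(2^pa+2)\big)\Big)\\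 =\frac14\Big(&-8\gamma_1\big(\tfrac12(2^na+1)\big)+8\log(i2^{-n})\,\psi^{(0)}\big(\tfrac12(2^na+1)\big)+8\gamma_1\big(\tfrac{a+2}4\big)\\ &+(-8\log 2-4i\pi)\,\psi^{(0)}\big(\tfrac{a+2}4\big)+4\log^2(i2^{-n})+(\pi-2i\log 2)^2\Big). \end{aligned}$$ -/

import Mathlib

namespace StieltjesSum

/-- `Z` is the Hurwitz zeta function `s ↦ ζ(s, v)` on the half-plane `Re s > 0` punctured at
`s = 1`: the analytic continuation of `∑ (n + v)^(-s)`, `Re s > 1` (principal powers).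
The domain is connected, so `Z` is unique on it; it contains a punctured neighbourhood of the
pole `s = 1`, which is all that the Laurent coefficients there depend on. -/
def IsHurwitzZeta (v : ℂ) (Z : ℂ → ℂ) : Prop :=
  DifferentiableOn ℂ Z {s : ℂ | 0 < s.re ∧ s ≠ 1} ∧
    ∀ s : ℂ, 1 < s.re → HasSum (fun n : ℕ => ((n : ℂ) + v) ^ (-s)) (Z s)

/-- The Hurwitz zeta function `ζ(s, v)` for `Re s > 0`, `s ≠ 1`, `v ≠ 0, -1, -2, …`. -/
noncomputable def hurwitzZeta (v : ℂ) : ℂ → ℂ :=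
  Classical.epsilon (IsHurwitzZeta v)

/-- `c` is the sequence of generalized Stieltjes constants at `v`, i.e. near `s = 1`
`ζ(s, v) = 1 / (s - 1) + ∑ₖ (-1)^k / k! * c k * (s - 1)^k`. -/
def IsStieltjesSeq (v : ℂ) (c : ℕ → ℂ) : Prop :=
  ∃ r : ℝ, 0 < r ∧ ∀ s : ℂ, s ≠ 1 → ‖s - 1‖ < r →
    HasSum (fun k : ℕ => (-1) ^ k / (Nat.factorial k : ℂ) * c k * (s - 1) ^ k)
      (hurwitzZeta v s - 1 / (s - 1))

/-- The generalized Stieltjes constant `γ_k(v)`. -/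
noncomputable def stieltjes (k : ℕ) (v : ℂ) : ℂ :=
  Classical.epsilon (IsStieltjesSeq v) k

/-- The harmonic number `H_z = ψ(z + 1) + γ` of complex index. -/
noncomputable def harmonicNumber (z : ℂ) : ℂ :=
  Complex.digamma (z + 1) + (Real.eulerMascheroniConstant : ℂ)

end StieltjesSum

namespace StieltjesSum

open Filter Topology

/-! The sum telescopes. With v = w_p = 2^p a/4 + 1/2, the arguments in the p-th summand are v, v +
1/2, 2v and w_{p+1}. The duplication formula ζ(s,v) + ζ(s,v+1/2) = 2^s ζ(s,2v), expanded at s = 1,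
gives `digamma_duplication` at order 0 and `stieltjes_one_duplication` at order 1. They eliminate v
+ 1/2, and the terms at 2v cancel because log(i2^{1-p}) drops by log 2 at each step. What is left is
U(p+1) - U(p), where U(p) = -2γ₁(w_p) + 2 l_p ψ(w_p) + l_p² and l_p = log(i2^{1-p}).

The analytic work is to write ζ(s,v) = 1/(s-1) + R_v(s) with R_v holomorphic on Re s > 0, and to
identify R_v(1) = -ψ(v) and R_v'(1) = -γ₁(v). -/

/-! ### Convergence and holomorphy of ζ(s,v) - ζ(s) as a series -/

/-- Mean value inequality on a half-plane. It gains one power of c over the separate terms, which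
moves convergence from Re s > 1 to Re s > 0. -/
lemma norm_cpow_neg_sub_cpow_neg_le {c : ℝ} (hc : 0 < c) {z w s : ℂ} (hz : c ≤ z.re)
    (hw : c ≤ w.re) (hs : 0 ≤ s.re) :
    ‖z ^ (-s) - w ^ (-s)‖ ≤
      ‖s‖ * Real.exp (Real.pi * |s.im|) * c ^ (-1 - s.re) * ‖z - w‖ := by
  have hconv : Convex ℝ {x : ℂ | c ≤ x.re} := convex_halfSpace_re_ge c
  refine hconv.norm_image_sub_le_of_norm_hasDerivWithin_le (𝕜 := ℂ) (f := fun x : ℂ => x ^ (-s))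
    (f' := fun x : ℂ => -s * x ^ (-s - 1)) (fun x hx => ?_) (fun x hx => ?_) hw hz
  · have hx0 : 0 < x.re := hc.trans_le hx
    have := (hasDerivAt_id x).cpow_const (c := -s) (Or.inl hx0)
    simpa using this.hasDerivWithinAt
  · have hx0 : 0 < x.re := hc.trans_le hx
    have hxn : x ≠ 0 := by rintro rfl; simp at hx0
    have hcx : c ≤ ‖x‖ := le_trans hx (Complex.re_le_norm x)
    rw [norm_mul, norm_neg, Complex.norm_cpow_of_ne_zero hxn, mul_assoc]
    refine mul_le_mul_of_nonneg_left ?_ (norm_nonneg s)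
    have h1 : ‖x‖ ^ (-s - 1).re ≤ c ^ (-1 - s.re) := by
      have : (-s - 1).re = -1 - s.re := by simp; ring
      rw [this]
      exact Real.rpow_le_rpow_of_nonpos hc hcx (by linarith)
    have h2 : (Real.exp (x.arg * (-s - 1).im))⁻¹ ≤ Real.exp (Real.pi * |s.im|) := by
      rw [← Real.exp_neg]
      refine Real.exp_le_exp.2 ?_
      have : -(x.arg * (-s - 1).im) = x.arg * s.im := by simp
      rw [this]
      calc x.arg * s.im ≤ |x.arg * s.im| := le_abs_self _
        _ = |x.arg| * |s.im| := abs_mul _ _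
        _ ≤ Real.pi * |s.im| :=
          mul_le_mul_of_nonneg_right (Complex.abs_arg_le_pi x) (abs_nonneg _)
    rw [div_eq_mul_inv, mul_comm]
    exact mul_le_mul h2 h1 (by positivity) (by positivity)

/-- The terms of the series expressing `ζ(s, v) - ζ(s)`. -/
noncomputable def hurwitzDiffTerm (n : ℕ) (v s : ℂ) : ℂ :=
  ((n : ℂ) + v) ^ (-s) - ((n : ℂ) + 1) ^ (-s)

/-- The difference `ζ(s, v) - ζ(s)` as a series convergent for `0 < Re s`. -/
noncomputable def hurwitzDiff (v s : ℂ) : ℂ := ∑' n : ℕ, hurwitzDiffTerm n v s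

lemma summable_nat_add_one_rpow {δ : ℝ} (hδ : 0 < δ) (C : ℝ) :
    Summable (fun n : ℕ => C * ((n : ℝ) + 1) ^ (-1 - δ)) := by
  have h := (summable_nat_add_iff 1).2 (Real.summable_nat_rpow.2 (show -1 - δ < -1 by linarith))
  simpa using h.mul_left C

lemma norm_hurwitzDiffTerm_add_le {N : ℕ} {R M δ : ℝ} (hN : R + 1 ≤ N) (hδ : 0 ≤ δ)
    {v s : ℂ} (hv : ‖v‖ ≤ R) (hs : ‖s‖ ≤ M) (hre : δ ≤ s.re) (n : ℕ) :
    ‖hurwitzDiffTerm (n + N) v s‖ ≤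
      M * Real.exp (Real.pi * M) * (R + 1) * ((n : ℝ) + 1) ^ (-1 - δ) := by
  have hn : (0 : ℝ) ≤ n := n.cast_nonneg
  have hR : 0 ≤ R := (norm_nonneg v).trans hv
  have hM : 0 ≤ M := (norm_nonneg s).trans hs
  have hvre : -R ≤ v.re := by
    have := (abs_le.1 (Complex.abs_re_le_norm v)).1
    linarith
  have h := norm_cpow_neg_sub_cpow_neg_le (c := (n : ℝ) + 1) (by linarith)
    (z := ((n + N : ℕ) : ℂ) + v) (w := ((n + N : ℕ) : ℂ) + 1) (s := s)
    (by simp; linarith) (by simp) (hδ.trans hre)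
  refine h.trans ?_
  have h1 : ‖((n + N : ℕ) : ℂ) + v - (((n + N : ℕ) : ℂ) + 1)‖ ≤ R + 1 := by
    rw [add_sub_add_left_eq_sub]
    refine (norm_sub_le _ _).trans ?_
    simpa using hv
  have h2 : ((n : ℝ) + 1) ^ (-1 - s.re) ≤ ((n : ℝ) + 1) ^ (-1 - δ) :=
    Real.rpow_le_rpow_of_exponent_le (by linarith) (by linarith)
  have h3 : |s.im| ≤ M := (Complex.abs_im_le_norm s).trans hs
  calc _ ≤ M * Real.exp (Real.pi * M) * ((n : ℝ) + 1) ^ (-1 - δ) * (R + 1) := by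
        gcongr
    _ = _ := by ring

lemma summable_hurwitzDiffTerm (v : ℂ) {s : ℂ} (hs : 0 < s.re) :
    Summable (fun n : ℕ => hurwitzDiffTerm n v s) := by
  obtain ⟨N, hN⟩ := exists_nat_ge (‖v‖ + 1)
  rw [← summable_nat_add_iff N]
  exact Summable.of_norm_bounded (summable_nat_add_one_rpow hs _)
    (norm_hurwitzDiffTerm_add_le hN hs.le le_rfl le_rfl le_rfl)

/-- Weierstrass M-test on tails: the shift N lets finitely many terms escape the uniform bound, as n
+ v may lie outside the right half-plane for small n. -/
lemma differentiableOn_tsum_of_locally_summable_tail {F : ℕ → ℂ → ℂ} {U : Set ℂ}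
    (hF : ∀ n, DifferentiableOn ℂ (F n) U)
    (hsum : ∀ x ∈ U, Summable (fun n => F n x))
    (hb : ∀ x ∈ U, ∃ V ⊆ U, IsOpen V ∧ x ∈ V ∧ ∃ u : ℕ → ℝ, Summable u ∧
      ∃ N : ℕ, ∀ n, ∀ y ∈ V, ‖F (n + N) y‖ ≤ u n) :
    DifferentiableOn ℂ (fun x => ∑' n, F n x) U := by
  intro x hx
  obtain ⟨V, hVU, hV, hxV, u, hu, N, hN⟩ := hb x hx
  have h1 : DifferentiableOn ℂ (fun y => ∑' n, F (n + N) y) V :=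
    Complex.differentiableOn_tsum_of_summable_norm hu (fun n => (hF (n + N)).mono hVU) hV
      (fun n y hy => hN n y hy)
  have h2 : DifferentiableOn ℂ (fun y => ∑ n ∈ Finset.range N, F n y) V :=
    DifferentiableOn.fun_sum (fun n _ => (hF n).mono hVU)
  have h3 : DifferentiableOn ℂ (fun x => ∑' n, F n x) V :=
    (h2.add h1).congr (fun y hy => ((hsum y (hVU hy)).sum_add_tsum_nat_add N).symm)
  exact (h3.differentiableAt (hV.mem_nhds hxV)).differentiableWithinAt

lemma differentiableOn_hurwitzDiff (v : ℂ) :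
    DifferentiableOn ℂ (hurwitzDiff v) {s : ℂ | 0 < s.re} := by
  refine differentiableOn_tsum_of_locally_summable_tail
    (F := fun n s => hurwitzDiffTerm n v s) (fun n s hs => ?_)
    (fun s hs => summable_hurwitzDiffTerm v hs) (fun s hs => ?_)
  -- A nonzero exponent gives differentiability even if the base n + v vanishes, so v needs no
  -- restriction here.
  · have hs0 : -s ≠ 0 := by
      rintro h
      rw [neg_eq_zero] at h
      subst h
      simp at hs
    refine DifferentiableAt.differentiableWithinAt ?_
    exact (differentiableAt_id.neg.const_cpow (Or.inr hs0)).sub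
      (differentiableAt_id.neg.const_cpow (Or.inr hs0))
  · obtain ⟨N, hN⟩ := exists_nat_ge (‖v‖ + 1)
    have hs' : 0 < s.re := hs
    refine ⟨{z | s.re / 2 < z.re} ∩ Metric.ball 0 (‖s‖ + 1), fun z hz => ?_,
      (isOpen_lt continuous_const Complex.continuous_re).inter Metric.isOpen_ball,
      ⟨by simp only [Set.mem_ofPred_eq]; linarith, by simp⟩, _,
      summable_nat_add_one_rpow (half_pos hs') _, N, fun n z hz =>
        norm_hurwitzDiffTerm_add_le (M := ‖s‖ + 1) hN (half_pos hs').le le_rfl ?_ hz.1.le n⟩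
    · have := hz.1
      simp only [Set.mem_ofPred_eq] at this ⊢
      linarith
    · exact (mem_ball_zero_iff.1 hz.2).le

lemma isOpen_ne_neg_nat : IsOpen {v : ℂ | ∀ m : ℕ, v ≠ -m} := by
  have : {v : ℂ | ∀ m : ℕ, v ≠ -m} = {v : ℂ | (Complex.Gamma v)⁻¹ ≠ 0} := by
    ext v
    simp [Complex.Gamma_eq_zero_iff]
  rw [this]
  exact isOpen_ne_fun Complex.differentiable_one_div_Gamma.continuous continuous_const

lemma differentiableOn_hurwitzDiff_one :
    DifferentiableOn ℂ (fun v => hurwitzDiff v 1) {v : ℂ | ∀ m : ℕ, v ≠ -m} := by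
  refine differentiableOn_tsum_of_locally_summable_tail
    (F := fun n v => hurwitzDiffTerm n v 1) (fun n v hv => ?_)
    (fun v hv => summable_hurwitzDiffTerm v (by simp)) (fun v hv => ?_)
  · refine DifferentiableAt.differentiableWithinAt ?_
    have h0 : (n : ℂ) + v ≠ 0 := fun h => hv n (eq_neg_of_add_eq_zero_right h)
    simp only [hurwitzDiffTerm, Complex.cpow_neg_one]
    exact (((differentiableAt_const _).add differentiableAt_id).inv h0).sub_const _
  · obtain ⟨N, hN⟩ := exists_nat_ge ((‖v‖ + 1) + 1)
    refine ⟨{v : ℂ | ∀ m : ℕ, v ≠ -m} ∩ Metric.ball 0 (‖v‖ + 1), Set.inter_subset_left,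
      isOpen_ne_neg_nat.inter Metric.isOpen_ball, ⟨hv, by simp⟩, _,
      summable_nat_add_one_rpow one_pos _, N, fun n z hz =>
        norm_hurwitzDiffTerm_add_le (M := 1) hN zero_le_one ?_ (by simp) (by simp) n⟩
    exact (mem_ball_zero_iff.1 hz.2).le

/-! ### Existence and uniqueness of the continuation -/

/-- The regular part `ζ(s, v) - 1 / (s - 1)` of the Hurwitz zeta function, for `0 < Re s`. -/
noncomputable def hurwitzRegular (v s : ℂ) : ℂ := riemannZeta₀ s + hurwitzDiff v s

lemma isOpen_re_pos : IsOpen {s : ℂ | 0 < s.re} :=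
  isOpen_lt continuous_const Complex.continuous_re

lemma differentiableOn_hurwitzRegular (v : ℂ) :
    DifferentiableOn ℂ (hurwitzRegular v) {s : ℂ | 0 < s.re} :=
  differentiable_riemannZeta₀.differentiableOn.add (differentiableOn_hurwitzDiff v)

lemma analyticAt_hurwitzRegular_one (v : ℂ) : AnalyticAt ℂ (hurwitzRegular v) 1 :=
  (differentiableOn_hurwitzRegular v).analyticAt (isOpen_re_pos.mem_nhds (by simp))

lemma hasSum_hurwitzRegular (v : ℂ) {s : ℂ} (hs : 1 < s.re) :
    HasSum (fun n : ℕ => ((n : ℂ) + v) ^ (-s)) (1 / (s - 1) + hurwitzRegular v s) := by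
  have hs1 : s ≠ 1 := by rintro rfl; simp at hs
  have h1 : HasSum (fun n : ℕ => ((n : ℂ) + 1) ^ (-s)) (riemannZeta s) := by
    have hsum : Summable (fun n : ℕ => ((n : ℂ) + 1) ^ (-s)) := by
      have := (summable_nat_add_iff 1).2 (Complex.summable_one_div_nat_cpow.2 hs)
      simpa [Complex.cpow_neg] using this
    rw [zeta_eq_tsum_one_div_nat_add_one_cpow hs]
    simpa [Complex.cpow_neg] using hsum.hasSum
  have h2 := (summable_hurwitzDiffTerm v (zero_lt_one.trans hs)).hasSum
  have h3 : 1 / (s - 1) + hurwitzRegular v s = riemannZeta s + hurwitzDiff v s := by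
    rw [riemannZeta_eq_inv_sub_add hs1, hurwitzRegular, one_div, add_assoc]
  rw [h3]
  convert! h1.add h2 using 2 with n
  simp [hurwitzDiffTerm]

lemma isHurwitzZeta_regular (v : ℂ) :
    IsHurwitzZeta v (fun s => 1 / (s - 1) + hurwitzRegular v s) := by
  refine ⟨?_, fun s hs => hasSum_hurwitzRegular v hs⟩
  refine DifferentiableOn.add (f := fun s : ℂ => 1 / (s - 1)) (fun s hs => ?_)
    ((differentiableOn_hurwitzRegular v).mono fun s hs => hs.1)
  exact ((differentiableAt_const (1 : ℂ)).div (differentiableAt_id.sub_const (1 : ℂ))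
    (sub_ne_zero.2 hs.2)).differentiableWithinAt

lemma isPreconnected_re_pos_ne_one : IsPreconnected {s : ℂ | 0 < s.re ∧ s ≠ 1} := by
  have hpos : Convex ℝ {s : ℂ | 0 < s.re} := convex_halfSpace_re_gt 0
  have hA := (hpos.inter (convex_halfSpace_im_gt 0)).isPreconnected
  have hB := (hpos.inter (convex_halfSpace_im_lt 0)).isPreconnected
  have hC := (convex_halfSpace_re_gt 1).isPreconnected
  have hE := (hpos.inter (convex_halfSpace_re_lt 1)).isPreconnected
  -- Four convex pieces cover the punctured half-plane: Re s > 1, the two open quadrants and the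
  -- strip 0 < Re s < 1. They are glued at explicit common points.
  have hCA := IsPreconnected.union (2 + Complex.I) (by simp) (by simp) hC hA
  have hCAB := IsPreconnected.union (2 - Complex.I) (by simp) (by simp) hCA hB
  have h := IsPreconnected.union (1 / 2 + Complex.I) (by simp) (by norm_num) hCAB hE
  convert h using 1
  ext s
  simp only [Set.mem_ofPred_eq, Set.mem_union, Set.mem_inter_iff, ne_eq, Complex.ext_iff,
    Complex.one_re, Complex.one_im]
  constructor
  · rintro ⟨h1, h2⟩
    rcases lt_trichotomy s.im 0 with h | h | h
    · tauto
    · rcases lt_trichotomy s.re 1 with h' | h' | h' <;> tauto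
    · tauto
  · rintro (((h | h) | h) | h)
    · exact ⟨by linarith, fun h' => by linarith [h'.1]⟩
    · exact ⟨h.1, fun h' => by linarith [h'.2, h.2]⟩
    · exact ⟨h.1, fun h' => by linarith [h'.2, h.2]⟩
    · exact ⟨h.1, fun h' => by linarith [h'.1, h.2]⟩

lemma IsHurwitzZeta.eqOn {v : ℂ} {Z W : ℂ → ℂ} (hZ : IsHurwitzZeta v Z)
    (hW : IsHurwitzZeta v W) : Set.EqOn Z W {s : ℂ | 0 < s.re ∧ s ≠ 1} := by
  have hopen : IsOpen {s : ℂ | 0 < s.re ∧ s ≠ 1} := isOpen_re_pos.inter isOpen_ne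
  refine (hZ.1.analyticOnNhd hopen).eqOn_of_preconnected_of_eventuallyEq
    (hW.1.analyticOnNhd hopen) isPreconnected_re_pos_ne_one
    (z₀ := 2) ⟨by simp, by norm_num⟩ ?_
  have : {s : ℂ | 1 < s.re} ∈ 𝓝 (2 : ℂ) :=
    (isOpen_lt continuous_const Complex.continuous_re).mem_nhds (by simp)
  filter_upwards [this] with s hs
  exact (hZ.2 s hs).unique (hW.2 s hs)

lemma hurwitzZeta_eq (v : ℂ) {s : ℂ} (hs : 0 < s.re) (hs1 : s ≠ 1) :
    hurwitzZeta v s = 1 / (s - 1) + hurwitzRegular v s :=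
  (Classical.epsilon_spec (p := IsHurwitzZeta v) ⟨_, isHurwitzZeta_regular v⟩).eqOn
    (isHurwitzZeta_regular v) ⟨hs, hs1⟩

/-! ### Stieltjes constants as Taylor data of the regular part -/

lemma re_pos_of_norm_sub_one_lt {s : ℂ} (hs : ‖s - 1‖ < 1) : 0 < s.re := by
  have := (abs_lt.1 ((Complex.abs_re_le_norm (s - 1)).trans_lt hs)).1
  simp at this
  linarith

lemma exists_isStieltjesSeq (v : ℂ) : ∃ c, IsStieltjesSeq v c := by
  refine ⟨fun k => (-1) ^ k * iteratedDeriv k (hurwitzRegular v) 1, 1, one_pos,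
    fun s hs1 hs => ?_⟩
  have hd : DifferentiableOn ℂ (hurwitzRegular v) (Metric.ball 1 1) :=
    (differentiableOn_hurwitzRegular v).mono fun z hz =>
      re_pos_of_norm_sub_one_lt (mem_ball_iff_norm.1 hz)
  have h := Complex.hasSum_taylorSeries_on_ball hd (mem_ball_iff_norm.2 hs)
  rw [hurwitzZeta_eq v (re_pos_of_norm_sub_one_lt hs) hs1, add_sub_cancel_left]
  convert! h using 2 with k
  have hsq : ((-1 : ℂ) ^ k) * (-1) ^ k = 1 := by rw [← mul_pow]; simp
  simp only [smul_eq_mul]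
  linear_combination (hsq * (k.factorial : ℂ)⁻¹ * iteratedDeriv k (hurwitzRegular v) 1 * (s - 1) ^ k)

lemma IsStieltjesSeq.hasFPowerSeriesAt {v : ℂ} {c : ℕ → ℂ} (hc : IsStieltjesSeq v c) :
    HasFPowerSeriesAt (hurwitzRegular v)
      (FormalMultilinearSeries.ofScalars ℂ fun k : ℕ => (-1) ^ k / (Nat.factorial k : ℂ) * c k)
      1 := by
  obtain ⟨r, hr, h⟩ := hc
  set p := FormalMultilinearSeries.ofScalars ℂ
    (fun k : ℕ => (-1) ^ k / (Nat.factorial k : ℂ) * c k) with hp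
  -- `IsStieltjesSeq` says nothing at s = 1, so the value there is patched to c 0; continuity then
  -- shows that the patch changes nothing.
  let F : ℂ → ℂ := Function.update (hurwitzRegular v) 1 (c 0)
  have hball : ∀ᶠ s : ℂ in 𝓝 1, ‖s - 1‖ < min r 1 := by
    filter_upwards [Metric.ball_mem_nhds (1 : ℂ) (lt_min hr one_pos)] with s hs
    exact mem_ball_iff_norm.1 hs
  have hF : HasFPowerSeriesAt F p 1 := by
    rw [hasFPowerSeriesAt_iff']
    filter_upwards [hball] with s hs
    by_cases hs1 : s = 1
    · subst hs1
      convert hasSum_single (0 : ℕ) _ using 1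
      · simp [F, hp]
      · intro n hn
        simp [hn]
    · have h1 := h s hs1 (hs.trans_le (min_le_left _ _))
      rw [hurwitzZeta_eq v (re_pos_of_norm_sub_one_lt (hs.trans_le (min_le_right _ _))) hs1,
        add_sub_cancel_left] at h1
      simp only [F, Function.update_of_ne hs1]
      convert! h1 using 2 with k
      simp [hp, mul_comm]
  have hcont := hF.continuousAt
  have heq : c 0 = hurwitzRegular v 1 := by
    have h1 : Tendsto (hurwitzRegular v) (𝓝[≠] 1) (𝓝 (c 0)) :=
      continuousAt_update_same.1 hcont
    exact tendsto_nhds_unique h1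
      ((analyticAt_hurwitzRegular_one v).continuousAt.tendsto.mono_left nhdsWithin_le_nhds)
  have : F = hurwitzRegular v := by simp [F, heq]
  rwa [this] at hF

lemma stieltjes_one_eq (v : ℂ) : stieltjes 1 v = -deriv (hurwitzRegular v) 1 := by
  have h := (Classical.epsilon_spec (exists_isStieltjesSeq v)).hasFPowerSeriesAt.deriv
  rw [h]
  simp [stieltjes]

/-! ### Digamma as the constant term -/

lemma digamma_ofReal {x : ℝ} (hx : 0 < x) :
    Complex.digamma (x : ℂ) = ((deriv (Real.log ∘ Real.Gamma) x : ℝ) : ℂ) := by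
  have hne : ∀ m : ℕ, x ≠ -m := fun m => by
    have : (0 : ℝ) ≤ m := m.cast_nonneg
    intro h
    linarith
  have hne' : ∀ m : ℕ, (x : ℂ) ≠ -m := fun m h => hne m (by exact_mod_cast h)
  have h1 := (Complex.differentiableAt_Gamma (x : ℂ) hne').hasDerivAt.comp_ofReal
  have h2 := (Real.differentiableAt_Gamma hne).hasDerivAt.ofReal_comp
  have h3 : deriv Complex.Gamma (x : ℂ) = ((deriv Real.Gamma x : ℝ) : ℂ) := by
    refine h1.unique (h2.congr_of_eventuallyEq (Eventually.of_forall fun y => ?_))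
    exact Complex.Gamma_ofReal y
  rw [Complex.digamma_def, logDeriv_apply, h3, Complex.Gamma_ofReal, Function.comp_def,
    deriv.log (Real.differentiableAt_Gamma hne) (Real.Gamma_pos_of_pos hx).ne']
  push_cast
  rfl

lemma differentiableAt_log_Gamma {x : ℝ} (hx : 0 < x) :
    DifferentiableAt ℝ (Real.log ∘ Real.Gamma) x := by
  refine (Real.differentiableAt_Gamma fun m => ?_).log (Real.Gamma_pos_of_pos hx).ne'
  have : (0 : ℝ) ≤ m := m.cast_nonneg
  intro h
  linarith

lemma log_Gamma_add_one {x : ℝ} (hx : 0 < x) :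
    (Real.log ∘ Real.Gamma) (x + 1) = (Real.log ∘ Real.Gamma) x + Real.log x := by
  simp only [Function.comp_apply, Real.Gamma_add_one hx.ne',
    Real.log_mul hx.ne' (Real.Gamma_pos_of_pos hx).ne', add_comm]

lemma deriv_log_Gamma_add_one {x : ℝ} (hx : 0 < x) :
    deriv (Real.log ∘ Real.Gamma) (x + 1) = deriv (Real.log ∘ Real.Gamma) x + 1 / x := by
  rw [← deriv_comp_add_const, one_div, ← Real.deriv_log,
    ← deriv_add (differentiableAt_log_Gamma hx) (Real.differentiableAt_log hx.ne')]
  apply EventuallyEq.deriv_eq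
  filter_upwards [eventually_gt_nhds hx] with y hy using log_Gamma_add_one hy

lemma log_le_deriv_log_Gamma_add_one {x : ℝ} (hx : 0 < x) :
    Real.log x ≤ deriv (Real.log ∘ Real.Gamma) (x + 1) := by
  have hx1 : 0 < x + 1 := by linarith
  have h := Real.convexOn_log_Gamma.slope_le_deriv (Set.mem_Ioi.2 hx) (Set.mem_Ioi.2 hx1)
    (by linarith) (differentiableAt_log_Gamma hx1)
  rwa [slope_def_field, log_Gamma_add_one hx, add_sub_cancel_left, add_sub_cancel_left,
    div_one] at h

lemma deriv_log_Gamma_le_log {x : ℝ} (hx : 0 < x) :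
    deriv (Real.log ∘ Real.Gamma) x ≤ Real.log x := by
  have hx1 : 0 < x + 1 := by linarith
  have h := Real.convexOn_log_Gamma.deriv_le_slope (Set.mem_Ioi.2 hx) (Set.mem_Ioi.2 hx1)
    (by linarith) (differentiableAt_log_Gamma hx)
  rwa [slope_def_field, log_Gamma_add_one hx, add_sub_cancel_left, add_sub_cancel_left,
    div_one] at h

/-- Log-convexity of Γ squeezes ψ(y) between log(y - 1) and log y. -/
lemma tendsto_deriv_log_Gamma_add_nat_sub_log {x : ℝ} (hx : 0 < x) :
    Tendsto (fun n : ℕ => deriv (Real.log ∘ Real.Gamma) (n + x) - Real.log n) atTop (𝓝 0) := by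
  have hlim (y : ℝ) : Tendsto (fun n : ℕ => Real.log (n + y) - Real.log n) atTop (𝓝 0) :=
    (Real.tendsto_log_comp_add_sub_log y).comp tendsto_natCast_atTop_atTop
  refine tendsto_of_tendsto_of_tendsto_of_le_of_le' (hlim (x - 1)) (hlim x) ?_ ?_
  · filter_upwards [eventually_ge_atTop 1] with n hn
    have hn' : (1 : ℝ) ≤ n := by exact_mod_cast hn
    have h := log_le_deriv_log_Gamma_add_one (x := n + (x - 1)) (by linarith)
    rw [show (n : ℝ) + (x - 1) + 1 = n + x by ring] at h
    linarith
  · filter_upwards with n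
    have hn : (0 : ℝ) ≤ n := n.cast_nonneg
    linarith [deriv_log_Gamma_le_log (x := n + x) (by linarith)]

lemma sum_hurwitzDiffTerm_one {x : ℝ} (hx : 0 < x) (n : ℕ) :
    ∑ k ∈ Finset.range n, hurwitzDiffTerm k x 1 =
      ((deriv (Real.log ∘ Real.Gamma) (n + x) - deriv (Real.log ∘ Real.Gamma) x
        - (harmonic n : ℝ) : ℝ) : ℂ) := by
  induction n with
  | zero => simp
  | succ n ih =>
    have hn : (0 : ℝ) < n + x := by positivity
    rw [Finset.sum_range_succ, ih, harmonic_succ, Nat.cast_succ, add_right_comm,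
      deriv_log_Gamma_add_one hn, hurwitzDiffTerm]
    simp only [Complex.cpow_neg_one]
    push_cast
    ring

lemma digamma_eq_neg_hurwitzRegular_ofReal {x : ℝ} (hx : 0 < x) :
    Complex.digamma (x : ℂ) = -hurwitzRegular x 1 := by
  have h1 := (summable_hurwitzDiffTerm (x : ℂ) (s := 1) (by simp)).hasSum.tendsto_sum_nat
  have h2 : Tendsto (fun n : ℕ => deriv (Real.log ∘ Real.Gamma) (n + x)
      - deriv (Real.log ∘ Real.Gamma) x - (harmonic n : ℝ)) atTop
      (𝓝 (0 - Real.eulerMascheroniConstant - deriv (Real.log ∘ Real.Gamma) x)) := by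
    have := ((tendsto_deriv_log_Gamma_add_nat_sub_log hx).sub
      Real.tendsto_harmonic_sub_log).sub_const (deriv (Real.log ∘ Real.Gamma) x)
    refine this.congr fun n => ?_
    ring
  have h3 := (Complex.continuous_ofReal.tendsto _).comp h2
  simp only [sum_hurwitzDiffTerm_one hx] at h1
  have h4 : hurwitzDiff x 1 = _ := tendsto_nhds_unique h1 h3
  rw [hurwitzRegular, riemannZeta₀_one, h4, digamma_ofReal hx]
  push_cast
  ring

/-- Identity theorem in v: both sides are holomorphic off the poles, a connected set, and agree at
real points accumulating at 1. -/
lemma digamma_eq_neg_hurwitzRegular {v : ℂ} (hv : ∀ m : ℕ, v ≠ -m) :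
    Complex.digamma v = -hurwitzRegular v 1 := by
  have hd : DifferentiableOn ℂ Complex.digamma {v : ℂ | ∀ m : ℕ, v ≠ -m} := by
    have hG : DifferentiableOn ℂ Complex.Gamma {v : ℂ | ∀ m : ℕ, v ≠ -m} := fun z hz =>
      (Complex.differentiableAt_Gamma z hz).differentiableWithinAt
    exact (hG.deriv isOpen_ne_neg_nat).div hG fun z hz => Complex.Gamma_ne_zero hz
  have hr : DifferentiableOn ℂ (fun v => -hurwitzRegular v 1) {v : ℂ | ∀ m : ℕ, v ≠ -m} :=
    (differentiableOn_hurwitzDiff_one.const_add _).neg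
  have hconn : IsPreconnected {v : ℂ | ∀ m : ℕ, v ≠ -m} := by
    have hc := ((Set.countable_range fun m : ℕ => -(m : ℂ)).isConnected_compl_of_one_lt_rank
      (by simp)).isPreconnected
    convert hc using 1
    ext z
    simp [eq_comm]
  have h1 : (1 : ℂ) ∈ {v : ℂ | ∀ m : ℕ, v ≠ -m} := fun m h => by
    have := congrArg Complex.re h
    simp at this
    linarith [m.cast_nonneg (α := ℝ)]
  refine (hd.analyticOnNhd isOpen_ne_neg_nat).eqOn_of_preconnected_of_frequently_eq
    (hr.analyticOnNhd isOpen_ne_neg_nat) hconn h1 ?_ hv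
  have ht : Tendsto (fun x : ℝ => (x : ℂ)) (𝓝[>] 1) (𝓝[≠] 1) := by
    refine tendsto_nhdsWithin_iff.2 ⟨?_, ?_⟩
    · exact (Complex.continuous_ofReal.tendsto' 1 1 (by simp)).mono_left nhdsWithin_le_nhds
    · filter_upwards [self_mem_nhdsWithin] with x hx
      simpa using (ne_of_gt hx : x ≠ 1)
  refine ht.frequently (Eventually.frequently ?_)
  filter_upwards [self_mem_nhdsWithin] with x hx
  exact digamma_eq_neg_hurwitzRegular_ofReal (zero_lt_one.trans hx)

/-! ### Duplication formulas -/

lemma two_mul_cpow (z s : ℂ) : (2 * z) ^ s = 2 ^ s * z ^ s := by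
  by_cases hz : z = 0
  · subst hz
    by_cases hs : s = 0
    · simp [hs]
    · simp [hs]
  · have h := Complex.log_ofReal_mul (r := 2) two_pos hz
    rw [Complex.ofReal_log two_pos.le, Complex.ofReal_ofNat] at h
    rw [Complex.cpow_def_of_ne_zero (mul_ne_zero two_ne_zero hz),
      Complex.cpow_def_of_ne_zero two_ne_zero, Complex.cpow_def_of_ne_zero hz, h, add_mul,
      Complex.exp_add]

/-- Splits ∑ (n + 2v)^(-s) into even and odd n, using 2k + 1 + 2v = 2(k + v + 1/2). The poles
combine to (2^s - 2)/(s - 1), cleared here so that the identity extends across s = 1. -/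
lemma hurwitzRegular_duplication_of_one_lt_re (v : ℂ) {s : ℂ} (hs : 1 < s.re) :
    (s - 1) * (hurwitzRegular v s + hurwitzRegular (v + 1 / 2) s
      - 2 ^ s * hurwitzRegular (2 * v) s) = 2 ^ s - 2 := by
  have hs1 : s - 1 ≠ 0 := by
    rw [sub_ne_zero]
    rintro rfl
    simp at hs
  have h2 : (2 : ℂ) ^ s * 2 ^ (-s) = 1 := by
    rw [← Complex.cpow_add _ _ two_ne_zero, add_neg_cancel, Complex.cpow_zero]
  have hev := (hasSum_hurwitzRegular v hs).mul_left ((2 : ℂ) ^ (-s))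
  have hodd := (hasSum_hurwitzRegular (v + 1 / 2) hs).mul_left ((2 : ℂ) ^ (-s))
  have hall : HasSum (fun n : ℕ => ((n : ℂ) + 2 * v) ^ (-s))
      (2 ^ (-s) * (1 / (s - 1) + hurwitzRegular v s)
        + 2 ^ (-s) * (1 / (s - 1) + hurwitzRegular (v + 1 / 2) s)) := by
    refine HasSum.even_add_odd ?_ ?_
    · convert! hev using 2 with k
      rw [← two_mul_cpow]
      push_cast
      ring_nf
    · convert! hodd using 2 with k
      rw [← two_mul_cpow]
      push_cast
      ring_nf
  have h := hall.unique (hasSum_hurwitzRegular (2 * v) hs)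
  have hi : (s - 1) * (1 / (s - 1)) = 1 := mul_one_div_cancel hs1
  linear_combination (s - 1) * 2 ^ s * h
    - (s - 1) * (2 * (1 / (s - 1)) + hurwitzRegular v s + hurwitzRegular (v + 1 / 2) s) * h2
    - (2 - 2 ^ s) * hi

lemma hurwitzRegular_duplication (v : ℂ) {s : ℂ} (hs : 0 < s.re) :
    (s - 1) * (hurwitzRegular v s + hurwitzRegular (v + 1 / 2) s
      - 2 ^ s * hurwitzRegular (2 * v) s) = 2 ^ s - 2 := by
  have hpow : Differentiable ℂ fun s : ℂ => (2 : ℂ) ^ s := fun s =>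
    differentiableAt_id.const_cpow (Or.inl two_ne_zero)
  have hl : DifferentiableOn ℂ (fun s => (s - 1) * (hurwitzRegular v s
      + hurwitzRegular (v + 1 / 2) s - 2 ^ s * hurwitzRegular (2 * v) s)) {s : ℂ | 0 < s.re} :=
    (differentiable_id.sub_const 1).differentiableOn.mul
      (((differentiableOn_hurwitzRegular v).add (differentiableOn_hurwitzRegular _)).sub
        (hpow.differentiableOn.mul (differentiableOn_hurwitzRegular _)))
  have hr : DifferentiableOn ℂ (fun s : ℂ => (2 : ℂ) ^ s - 2) {s : ℂ | 0 < s.re} :=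
    (hpow.sub_const 2).differentiableOn
  refine (hl.analyticOnNhd isOpen_re_pos).eqOn_of_preconnected_of_eventuallyEq
    (hr.analyticOnNhd isOpen_re_pos) (convex_halfSpace_re_gt 0).isPreconnected
    (z₀ := 2) (by simp) ?_ hs
  have : {s : ℂ | 1 < s.re} ∈ 𝓝 (2 : ℂ) :=
    (isOpen_lt continuous_const Complex.continuous_re).mem_nhds (by simp)
  filter_upwards [this] with s hs
  exact hurwitzRegular_duplication_of_one_lt_re v hs

/-- If `(s - 1) h(s) = 2 ^ s - 2` near `s = 1`, then `h(1)` and `h'(1)` are determined. -/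
lemma eq_and_deriv_eq_of_sub_one_mul_eq {h : ℂ → ℂ} (hh : AnalyticAt ℂ h 1)
    (heq : ∀ᶠ s in 𝓝 (1 : ℂ), (s - 1) * h s = 2 ^ s - 2) :
    h 1 = 2 * Complex.log 2 ∧ deriv h 1 = Complex.log 2 ^ 2 := by
  have hpow (s : ℂ) : HasDerivAt (fun s : ℂ => (2 : ℂ) ^ s) (2 ^ s * Complex.log 2) s := by
    simpa using (hasDerivAt_id s).const_cpow (c := 2) (Or.inl two_ne_zero)
  have hd : ∀ᶠ s in 𝓝 (1 : ℂ), h s + (s - 1) * deriv h s = 2 ^ s * Complex.log 2 := by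
    filter_upwards [heq.eventually_nhds, hh.eventually_analyticAt] with s hs has
    have h1 : HasDerivAt (fun s => (s - 1) * h s) (1 * h s + (s - 1) * deriv h s) s :=
      ((hasDerivAt_id s).sub_const 1).mul has.differentiableAt.hasDerivAt
    have h2 : HasDerivAt (fun s : ℂ => (2 : ℂ) ^ s - 2) (2 ^ s * Complex.log 2) s :=
      (hpow s).sub_const 2
    simpa using h1.unique (h2.congr_of_eventuallyEq hs)
  refine ⟨by simpa using hd.self_of_nhds, ?_⟩
  -- A second differentiation gives 2h'(1) = 2 log² 2.
  have h1 : HasDerivAt (fun s => h s + (s - 1) * deriv h s)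
      (deriv h 1 + (1 * deriv h 1 + (1 - 1) * deriv (deriv h) 1)) 1 :=
    hh.differentiableAt.hasDerivAt.add
      (((hasDerivAt_id (1 : ℂ)).sub_const 1).mul hh.deriv.differentiableAt.hasDerivAt)
  have h2 := h1.unique (((hpow 1).mul_const (Complex.log 2)).congr_of_eventuallyEq hd)
  rw [Complex.cpow_one] at h2
  linear_combination h2 / 2

lemma analyticAt_duplication (v : ℂ) : AnalyticAt ℂ (fun s => hurwitzRegular v s
    + hurwitzRegular (v + 1 / 2) s - 2 ^ s * hurwitzRegular (2 * v) s) 1 :=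
  ((analyticAt_hurwitzRegular_one v).add (analyticAt_hurwitzRegular_one _)).sub
    ((analyticAt_const.cpow analyticAt_id (by simp)).mul (analyticAt_hurwitzRegular_one _))

lemma eventually_hurwitzRegular_duplication (v : ℂ) : ∀ᶠ s in 𝓝 (1 : ℂ),
    (s - 1) * (hurwitzRegular v s + hurwitzRegular (v + 1 / 2) s
      - 2 ^ s * hurwitzRegular (2 * v) s) = 2 ^ s - 2 := by
  filter_upwards [isOpen_re_pos.mem_nhds (show (0 : ℝ) < (1 : ℂ).re by simp)] with s hs
  exact hurwitzRegular_duplication v hs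

lemma hurwitzRegular_duplication_one (v : ℂ) :
    hurwitzRegular v 1 + hurwitzRegular (v + 1 / 2) 1 - 2 * hurwitzRegular (2 * v) 1
      = 2 * Complex.log 2 := by
  have h := (eq_and_deriv_eq_of_sub_one_mul_eq (analyticAt_duplication v)
    (eventually_hurwitzRegular_duplication v)).1
  simpa using h

lemma digamma_duplication {v : ℂ} (hv : ∀ m : ℕ, 2 * v ≠ -m) :
    Complex.digamma v + Complex.digamma (v + 1 / 2) =
      2 * Complex.digamma (2 * v) - 2 * Complex.log 2 := by
  have h1 : ∀ m : ℕ, v ≠ -m := fun m h => hv (2 * m) (by rw [h]; push_cast; ring)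
  have h2 : ∀ m : ℕ, v + 1 / 2 ≠ -m := fun m h =>
    hv (2 * m + 1) (by rw [eq_sub_of_add_eq h]; push_cast; ring)
  rw [digamma_eq_neg_hurwitzRegular h1, digamma_eq_neg_hurwitzRegular h2,
    digamma_eq_neg_hurwitzRegular hv]
  linear_combination -hurwitzRegular_duplication_one v

lemma stieltjes_one_duplication {v : ℂ} (hv : ∀ m : ℕ, 2 * v ≠ -m) :
    stieltjes 1 v + stieltjes 1 (v + 1 / 2) = 2 * stieltjes 1 (2 * v)
      + 2 * Complex.log 2 * Complex.digamma (2 * v) - Complex.log 2 ^ 2 := by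
  have h := (eq_and_deriv_eq_of_sub_one_mul_eq (analyticAt_duplication v)
    (eventually_hurwitzRegular_duplication v)).2
  have hg (w : ℂ) := (analyticAt_hurwitzRegular_one w).differentiableAt.hasDerivAt
  have hpow : HasDerivAt (fun s : ℂ => (2 : ℂ) ^ s) (2 ^ (1 : ℂ) * Complex.log 2) 1 := by
    simpa using (hasDerivAt_id (1 : ℂ)).const_cpow (c := 2) (Or.inl two_ne_zero)
  have hd := (((hg v).add (hg (v + 1 / 2))).sub (hpow.mul (hg (2 * v)))).deriv
  have h' := hd.symm.trans h
  rw [Complex.cpow_one] at h'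
  rw [stieltjes_one_eq, stieltjes_one_eq, stieltjes_one_eq, digamma_eq_neg_hurwitzRegular hv]
  linear_combination -h'

/-! ### Telescoping -/

lemma log_I_mul_two_zpow (k : ℤ) :
    Complex.log (Complex.I * (2 : ℂ) ^ k) =
      k * Complex.log 2 + (Real.pi : ℂ) / 2 * Complex.I := by
  have h := Complex.log_ofReal_mul (r := (2 : ℝ) ^ k) (by positivity) Complex.I_ne_zero
  rw [Real.log_zpow, Complex.log_I] at h
  rw [mul_comm]
  push_cast [Complex.ofReal_log] at h
  simpa using h

end StieltjesSum

open StieltjesSum in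
theorem mainTheorem11 (n : ℕ) (a : ℂ)
    (ha : ∀ j : ℕ, 1 ≤ j → (2 : ℂ) ^ n * a ≠ -(j : ℂ)) :
    ∑ p ∈ Finset.range (n + 1),
        (Complex.log (Complex.I * (2 : ℂ) ^ (1 - (p : ℤ))) *
            (harmonicNumber ((2 : ℂ) ^ ((p : ℤ) - 2) * a)
              - harmonicNumber (1 / 4 * ((2 : ℂ) ^ p * a - 2)))
          + 2 * Complex.log (Complex.I * (2 : ℂ) ^ (-(p : ℤ))) *
            (harmonicNumber (1 / 2 * ((2 : ℂ) ^ p * a - 1))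
              - harmonicNumber ((2 : ℂ) ^ ((p : ℤ) - 1) * a))
          - stieltjes 1 ((2 : ℂ) ^ ((p : ℤ) - 2) * a + 1)
          + 2 * stieltjes 1 ((2 : ℂ) ^ ((p : ℤ) - 1) * a + 1)
          - 2 * stieltjes 1 (1 / 2 * ((2 : ℂ) ^ p * a + 1))
          + stieltjes 1 (1 / 4 * ((2 : ℂ) ^ p * a + 2)))
      = 1 / 4 *
        (-8 * stieltjes 1 (1 / 2 * ((2 : ℂ) ^ n * a + 1))
          + 8 * Complex.log (Complex.I * (2 : ℂ) ^ (-(n : ℤ))) *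
            Complex.digamma (1 / 2 * ((2 : ℂ) ^ n * a + 1))
          + 8 * stieltjes 1 ((a + 2) / 4)
          + (-8 * Complex.log 2 - 4 * Complex.I * (Real.pi : ℂ)) *
            Complex.digamma ((a + 2) / 4)
          + 4 * Complex.log (Complex.I * (2 : ℂ) ^ (-(n : ℤ))) ^ 2
          + ((Real.pi : ℂ) - 2 * Complex.I * Complex.log 2) ^ 2) := by
  let l : ℕ → ℂ := fun p => (1 - p) * Complex.log 2 + (Real.pi : ℂ) / 2 * Complex.I
  let w : ℕ → ℂ := fun p => 2 ^ p * a / 4 + 1 / 2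
  let U : ℕ → ℂ := fun p =>
    -2 * stieltjes 1 (w p) + 2 * l p * Complex.digamma (w p) + l p ^ 2
  have hw (p : ℕ) : w (p + 1) = 2 ^ p * a / 2 + 1 / 2 := by
    simp only [w, pow_succ]
    ring
  have hl (p : ℕ) : l (p + 1) = l p - Complex.log 2 := by
    simp only [l]
    push_cast
    ring
  have hlog (p : ℕ) : Complex.log (Complex.I * (2 : ℂ) ^ (1 - (p : ℤ))) = l p := by
    rw [log_I_mul_two_zpow]
    simp [l]
  have hlog' (p : ℕ) : Complex.log (Complex.I * (2 : ℂ) ^ (-(p : ℤ))) = l (p + 1) := by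
    rw [log_I_mul_two_zpow]
    simp [l]
  have hz2 (p : ℕ) : (2 : ℂ) ^ ((p : ℤ) - 2) * a = 2 ^ p * a / 4 := by
    rw [zpow_sub₀ two_ne_zero, zpow_natCast]
    norm_num
    ring
  have hz1 (p : ℕ) : (2 : ℂ) ^ ((p : ℤ) - 1) * a = 2 ^ p * a / 2 := by
    rw [zpow_sub₀ two_ne_zero, zpow_natCast]
    norm_num
    ring
  have hq (p : ℕ) : 1 / 4 * ((2 : ℂ) ^ p * a + 2) = w p := by
    simp only [w]
    ring
  have hh (p : ℕ) : 1 / 2 * ((2 : ℂ) ^ p * a + 1) = w (p + 1) := by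
    rw [hw]
    ring
  refine (Finset.sum_congr rfl fun p hp => (?_ : _ = U (p + 1) - U p)).trans ?_
  · have hpn : p ≤ n := Nat.lt_succ_iff.1 (Finset.mem_range.1 hp)
    have hv : ∀ m : ℕ, 2 * w p ≠ -m := fun m hm => by
      -- 2w_p = -m means 2^p a = -2(m + 1); multiplying by 2^(n-p) contradicts the hypothesis on 2^n
      -- a.
      refine ha (2 ^ (n - p) * (2 * (m + 1))) (Nat.mul_pos (by positivity) (by positivity)) ?_
      have h2 : (2 : ℂ) ^ n = 2 ^ (n - p) * 2 ^ p := by rw [← pow_add, Nat.sub_add_cancel hpn]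
      simp only [w] at hm
      rw [h2]
      push_cast
      linear_combination 2 * 2 ^ (n - p) * hm
    have hγ := stieltjes_one_duplication hv
    have hψ := digamma_duplication hv
    have e1 : w p + 1 / 2 = 2 ^ p * a / 4 + 1 := by simp only [w]; ring
    have e2 : 2 * w p = 2 ^ p * a / 2 + 1 := by simp only [w]; ring
    have e3 : 1 / 4 * ((2 : ℂ) ^ p * a - 2) + 1 = w p := by simp only [w]; ring
    have e4 : 1 / 2 * ((2 : ℂ) ^ p * a - 1) + 1 = w (p + 1) := by rw [hw]; ring
    rw [e1, e2] at hγ hψ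
    rw [hlog, hlog', hz2, hz1, hq, hh]
    simp only [harmonicNumber, e3, e4, U]
    rw [hl]
    linear_combination l p * hψ - hγ
  rw [Finset.sum_range_sub, hlog', hh]
  have hw0 : w 0 = (a + 2) / 4 := by
    simp only [w]
    ring
  have hl0 : l 0 = Complex.log 2 + (Real.pi : ℂ) / 2 * Complex.I := by simp [l]
  simp only [U]
  rw [hw0, hl0]
  -- The last square on the right is -4 l_0², since π - 2i log 2 = -2i l_0.
  linear_combination (-Complex.log 2 ^ 2 - (Real.pi : ℂ) ^ 2 / 4) * Complex.I_sq
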